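/- Let $R$ and $S$ be associative rings with identity; let $\operatorname{Mod} R$ and $\operatorname{Mod} S$ be their categories of left modules. Let ${}_RC_S$ be a semidualizing $(R,S)$-bimodule, that is: ${}_RC$ and $C_S$ each have a resolution by finitely generated projective modules (over $R$, respectively $S^{op}$); the homothety maps $R\to \operatorname{Hom}_{S^{op}}(C,C)$ and $S\to\operatorname{Hom}_R(C,C)$ are isomorphisms; and $\operatorname{Ext}^{i}_R(C,C)=0=\operatorname{Ext}^{i}_{S^{op}}(C,C)$ for all $i\geq 1$. Write $M_*=\operatorname{Hom}_R(C,M)$ for $M\in\operatorname{Mod} R$, a left $S$-module via $(sf)(c)=f(cs)$. The Auslander class $\mathcal{A}_C(S)$ consists of all $A\in\operatorname{Mod} S$ such that $\operatorname{Tor}^S_i(C,A)=0$ and $\operatorname{Ext}_R^i(C,C\otimes_SA)=0$ for all $i\geq1$ and such that $\mu_A:A\to (C\otimes_SA)_*$, $\mu_A(a)(c)=c\otimes a$, is an isomorphism. The Bass class $\mathcal{B}_C(R)$ consists of all $M\in\operatorname{Mod} R$ such that $\operatorname{Ext}_R^i(C,M)=0$ and $\operatorname{Tor}^S_i(C,M_*)=0$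 for all $i\geq1$ and such that $\theta_M:C\otimes_SM_*\to M$, $\theta_M(c\otimes f)=f(c)$, is an isomorphism. For a class $\mathscr{X}$ of modules, a homomorphism $f:X\to Y$ is an $\mathscr{X}$-cover of $Y$ if $X\in\mathscr{X}$, every homomorphism $X'\to Y$ with $X'\in\mathscr{X}$ factors through $f$, and every endomorphism $h$ of $X$ with $fh=f$ is an automorphism. Let $M\in\operatorname{Mod} R$ and let $g:A\to M_*$ be an $\mathcal{A}_C(S)$-cover of $M_*$ in $\operatorname{Mod} S$. Then $$\theta_M\circ(1_C\otimes g):C\otimes_SA\to M$$ is a $\mathcal{B}_C(R)$-cover of $M$ in $\operatorname{Mod} R$. -/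

import Mathlib

open CategoryTheory MulOpposite
open scoped TensorProduct

universe u

/-! ### Covers in a category of modules -/

section Covers

variable {R : Type u} [Ring R]

/-- `f : X ⟶ Y` is an `𝒳`-precover of `Y`: `X` lies in the class `𝒳`, and for every `X'` in `𝒳`
the map `Hom(X', f) : Hom(X', X) → Hom(X', Y)` is surjective. -/
def IsPrecover (𝒳 : ObjectProperty (ModuleCat.{u} R)) {X Y : ModuleCat.{u} R} (f : X ⟶ Y) : Prop :=
  𝒳 X ∧ ∀ X' : ModuleCat.{u} R, 𝒳 X' → Function.Surjective (fun h : X' ⟶ X => h ≫ f)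

/-- `f : X ⟶ Y` is right minimal: every endomorphism `h` of `X` with `f ∘ h = f`
is an automorphism. -/
def IsRightMinimal {X Y : ModuleCat.{u} R} (f : X ⟶ Y) : Prop :=
  ∀ h : X ⟶ X, h ≫ f = f → IsIso h

/-- An `𝒳`-cover is a right minimal `𝒳`-precover. -/
def IsCover (𝒳 : ObjectProperty (ModuleCat.{u} R)) {X Y : ModuleCat.{u} R} (f : X ⟶ Y) : Prop :=
  IsPrecover 𝒳 f ∧ IsRightMinimal f

end Covers

/-! ### The group `Hom_R(C, M)` -/

section BimodHom

/-- The abelian group `Hom_R(C, M)`. It is a type synonym (indexed by `S`) that will carry only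
the left `S`-module structure coming from a right action of `S` on `C`. -/
@[nolint unusedArguments]
def BimodHom (R _S C M : Type u) [Ring R] [AddCommGroup C] [Module R C] [AddCommGroup M]
    [Module R M] : Type u :=
  C →ₗ[R] M

variable {R S C M : Type u} [Ring R] [AddCommGroup C] [Module R C] [AddCommGroup M] [Module R M]

instance : AddCommGroup (BimodHom R S C M) := inferInstanceAs (AddCommGroup (C →ₗ[R] M))

instance : FunLike (BimodHom R S C M) C M := inferInstanceAs (FunLike (C →ₗ[R] M) C M)

instance : LinearMapClass (BimodHom R S C M) R C M :=
  inferInstanceAs (LinearMapClass (C →ₗ[R] M) R C M)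

@[ext]
theorem BimodHom.ext {f f' : BimodHom R S C M} (h : ∀ c, f c = f' c) : f = f' :=
  LinearMap.ext h

@[simp]
theorem BimodHom.add_apply (f f' : BimodHom R S C M) (c : C) : (f + f') c = f c + f' c := rfl

@[simp]
theorem BimodHom.zero_apply (c : C) : (0 : BimodHom R S C M) c = 0 := rfl

end BimodHom

/-! ### Tensor product and Hom with a bimodule

An `(R, S)`-bimodule is an abelian group `C` with commuting actions of `R` and of `Sᵐᵒᵖ`;
the right action is `c · s = op s • c`. Right `S`-modules are left `Sᵐᵒᵖ`-modules. -/

section Bimodule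

variable (R S : Type u) [Ring R] [Ring S]
variable (C : Type u) [AddCommGroup C] [Module R C] [Module Sᵐᵒᵖ C] [SMulCommClass R Sᵐᵒᵖ C]

section Tensor

variable (A : Type u) [AddCommGroup A] [Module S A]

/-- The additive subgroup of `C ⊗[ℤ] A` generated by the elements `c · s ⊗ a - c ⊗ s a`;
it is stable under the left action of `R`. -/
def balancedRelations : Submodule R (C ⊗[ℤ] A) :=
  { AddSubgroup.closure
      {t : C ⊗[ℤ] A | ∃ (c : C) (s : S) (a : A), t = (op s • c) ⊗ₜ[ℤ] a - c ⊗ₜ[ℤ] (s • a)} with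
    smul_mem' := by
      intro r t ht
      change t ∈ AddSubgroup.closure _ at ht
      change r • t ∈ AddSubgroup.closure _
      induction ht using AddSubgroup.closure_induction with
      | mem x hx =>
        obtain ⟨c, s, a, rfl⟩ := hx
        refine AddSubgroup.subset_closure ⟨r • c, s, a, ?_⟩
        rw [smul_sub, TensorProduct.smul_tmul', TensorProduct.smul_tmul', smul_comm]
      | zero => rw [smul_zero]; exact zero_mem _
      | add x y _ _ hx hy => rw [smul_add]; exact add_mem hx hy
      | neg x _ hx => rw [smul_neg]; exact neg_mem hx }

/-- The left `R`-module `C ⊗_S A`, with `r (c ⊗ a) = (r c) ⊗ a`. -/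
abbrev BimodTensor : Type u := (C ⊗[ℤ] A) ⧸ balancedRelations R S C A

variable {C A}

/-- The pure tensor `c ⊗ a` in `C ⊗_S A`. -/
def bimodTmul (c : C) (a : A) : BimodTensor R S C A :=
  (balancedRelations R S C A).mkQ (c ⊗ₜ[ℤ] a)

theorem bimodTmul_smul (c : C) (s : S) (a : A) :
    bimodTmul R S (op s • c) a = bimodTmul R S c (s • a) :=
  (Submodule.Quotient.eq _).2 (AddSubgroup.subset_closure ⟨c, s, a, rfl⟩)

variable {R S}

/-- An `R`-linear map that respects the defining relations vanishes on their span. -/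
theorem balancedRelations_le_ker {N : Type u} [AddCommGroup N] [Module R N]
    (φ : C ⊗[ℤ] A →ₗ[R] N)
    (h : ∀ (c : C) (s : S) (a : A), φ ((op s • c) ⊗ₜ[ℤ] a) = φ (c ⊗ₜ[ℤ] (s • a))) :
    balancedRelations R S C A ≤ LinearMap.ker φ := by
  intro t ht
  change t ∈ AddSubgroup.closure _ at ht
  have hle : AddSubgroup.closure
      {t : C ⊗[ℤ] A | ∃ (c : C) (s : S) (a : A), t = (op s • c) ⊗ₜ[ℤ] a - c ⊗ₜ[ℤ] (s • a)} ≤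
      φ.toAddMonoidHom.ker := by
    rw [AddSubgroup.closure_le]
    rintro _ ⟨c, s, a, rfl⟩
    change φ _ = 0
    rw [map_sub, h, sub_self]
  exact hle ht

variable (R S)

theorem bimodTensor_hom_ext {N : Type u} [AddCommGroup N] [Module R N]
    {φ ψ : BimodTensor R S C A →ₗ[R] N}
    (h : ∀ (c : C) (a : A), φ (bimodTmul R S c a) = ψ (bimodTmul R S c a)) : φ = ψ := by
  refine Submodule.linearMap_qext _ (LinearMap.ext fun t => ?_)
  induction t using TensorProduct.induction_on with
  | zero => simp
  | tmul c a => exact h c a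
  | add x y hx hy => rw [map_add, map_add, hx, hy]

variable (C)

/-- `1_C ⊗ g : C ⊗_S A → C ⊗_S A'` for an `S`-linear map `g : A → A'`. -/
def bimodTensorMap {A' : Type u} [AddCommGroup A'] [Module S A'] (g : A →ₗ[S] A') :
    BimodTensor R S C A →ₗ[R] BimodTensor R S C A' :=
  (balancedRelations R S C A).liftQ
    ((balancedRelations R S C A').mkQ ∘ₗ
      TensorProduct.AlgebraTensorModule.lTensor R C g.toAddMonoidHom.toIntLinearMap)
    (balancedRelations_le_ker _ fun c s a => by
      simpa [bimodTmul] using bimodTmul_smul R S c s (g a))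

@[simp]
theorem bimodTensorMap_tmul {A' : Type u} [AddCommGroup A'] [Module S A'] (g : A →ₗ[S] A')
    (c : C) (a : A) :
    bimodTensorMap R S C g (bimodTmul R S c a) = bimodTmul R S c (g a) := rfl

end Tensor

section Hom

/-- The right multiplication `c ↦ c · s`, as an `R`-linear map. -/
def rightMul (s : S) : C →ₗ[R] C where
  toFun c := op s • c
  map_add' := smul_add _
  map_smul' r c := (smul_comm r (op s) c).symm

/-- The left multiplication `c ↦ r c`, as a map of right `S`-modules. -/
def leftMul (r : R) : C →ₗ[Sᵐᵒᵖ] C where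
  toFun c := r • c
  map_add' := smul_add _
  map_smul' s c := smul_comm r s c

variable {R S C} {M : Type u} [AddCommGroup M] [Module R M]

/-- `(s f)(c) = f (c · s)`. -/
instance : SMul S (BimodHom R S C M) where
  smul s f := LinearMap.comp (show C →ₗ[R] M from f) (rightMul R S C s)

@[simp]
theorem BimodHom.smul_apply (s : S) (f : BimodHom R S C M) (c : C) :
    (s • f) c = f (op s • c) := rfl

instance : Module S (BimodHom R S C M) where
  one_smul f := by ext c; simp
  mul_smul s t f := by ext c; simp [mul_smul]
  smul_zero s := by ext c; simp
  smul_add s f f' := by ext c; simp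
  add_smul s t f := by ext c; simp [add_smul]
  zero_smul f := by ext c; simp

variable (R S C)

/-- `f_* : Hom_R(C, M) → Hom_R(C, M')`, `φ ↦ f ∘ φ`. -/
def bimodHomMap {M M' : Type u} [AddCommGroup M] [Module R M] [AddCommGroup M'] [Module R M']
    (f : M →ₗ[R] M') : BimodHom R S C M →ₗ[S] BimodHom R S C M' where
  toFun φ := LinearMap.comp f (show C →ₗ[R] M from φ)
  map_add' φ ψ := BimodHom.ext fun c => map_add f (φ c) (ψ c)
  map_smul' _ _ := rfl

@[simp]
theorem bimodHomMap_apply {M M' : Type u} [AddCommGroup M] [Module R M] [AddCommGroup M']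
    [Module R M'] (f : M →ₗ[R] M') (φ : BimodHom R S C M) (c : C) :
    bimodHomMap R S C f φ c = f (φ c) := rfl

end Hom

/-- The functor `C ⊗_S - : Mod S ⥤ Mod R`. -/
def tensorFunctor : ModuleCat.{u} S ⥤ ModuleCat.{u} R where
  obj A := ModuleCat.of R (BimodTensor R S C A)
  map g := ModuleCat.ofHom (bimodTensorMap R S C g.hom)
  map_id A := by
    ext1
    exact bimodTensor_hom_ext R S fun c a => rfl
  map_comp f g := by
    ext1
    exact bimodTensor_hom_ext R S fun c a => rfl

instance : (tensorFunctor R S C).Additive where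
  map_add {A A' f g} := by
    ext1
    refine bimodTensor_hom_ext R S fun c a => ?_
    change (balancedRelations R S C A').mkQ (c ⊗ₜ[ℤ] (f.hom a + g.hom a)) =
      (balancedRelations R S C A').mkQ (c ⊗ₜ[ℤ] f.hom a) +
        (balancedRelations R S C A').mkQ (c ⊗ₜ[ℤ] g.hom a)
    rw [TensorProduct.tmul_add, map_add]

/-- The functor `(-)_* = Hom_R(C, -) : Mod R ⥤ Mod S`. -/
def homFunctor : ModuleCat.{u} R ⥤ ModuleCat.{u} S where
  obj M := ModuleCat.of S (BimodHom R S C M)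
  map f := ModuleCat.ofHom (bimodHomMap R S C f.hom)
  map_id _ := rfl
  map_comp _ _ := rfl

/-- The valuation map `θ_M : C ⊗_S Hom_R(C, M) → M`, `c ⊗ f ↦ f c`. -/
def thetaMap (M : ModuleCat.{u} R) :
    (tensorFunctor R S C).obj ((homFunctor R S C).obj M) ⟶ M :=
  ModuleCat.ofHom <|
    (balancedRelations R S C (BimodHom R S C M)).liftQ
      (TensorProduct.AlgebraTensorModule.lift
        { toFun := fun c =>
            { toFun := fun f : BimodHom R S C M => f c
              map_add' := fun _ _ => rfl
              map_smul' := fun n f =>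
                map_zsmul (⟨⟨fun f : BimodHom R S C M => f c, rfl⟩, fun _ _ => rfl⟩ :
                  BimodHom R S C M →+ M) n f }
          map_add' := fun c c' => LinearMap.ext fun f => map_add f c c'
          map_smul' := fun r c => LinearMap.ext fun f => map_smul f r c })
      (balancedRelations_le_ker _ fun _ _ _ => rfl)

/-- The defining formula of `θ_M`. -/
theorem thetaMap_tmul (M : ModuleCat.{u} R) (c : C) (f : BimodHom R S C M) :
    (thetaMap R S C M).hom (bimodTmul R S c f) = f c := rfl

/-- The valuation map `μ_A : A → Hom_R(C, C ⊗_S A)`, `a ↦ (c ↦ c ⊗ a)`. -/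
def muMap (A : ModuleCat.{u} S) :
    A ⟶ (homFunctor R S C).obj ((tensorFunctor R S C).obj A) :=
  ModuleCat.ofHom
    { toFun := fun a =>
        (show C →ₗ[R] BimodTensor R S C A from
          { toFun := fun c => bimodTmul R S c a
            map_add' := fun c c' => by
              simp only [bimodTmul, TensorProduct.add_tmul, map_add]
            map_smul' := fun _ _ => rfl })
      map_add' := fun a a' => BimodHom.ext fun c => by
        change (balancedRelations R S C A).mkQ (c ⊗ₜ[ℤ] (a + a')) =
          (balancedRelations R S C A).mkQ (c ⊗ₜ[ℤ] a) +
            (balancedRelations R S C A).mkQ (c ⊗ₜ[ℤ] a')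
        rw [TensorProduct.tmul_add, map_add]
      map_smul' := fun s a => BimodHom.ext fun c => (bimodTmul_smul R S c s a).symm }

/-- The defining formula of `μ_A`. -/
theorem muMap_apply (A : ModuleCat.{u} S) (a : A) (c : C) :
    (show BimodHom R S C (BimodTensor R S C A) from (muMap R S C A).hom a) c =
      bimodTmul R S c a := rfl

/-- `Tor_n^S(C, A) = 0`, where `Tor_n^S(C, -)` is the `n`-th left derived functor of `C ⊗_S -`. -/
def TorVanishes (n : ℕ) (A : ModuleCat.{u} S) : Prop :=
  Limits.IsZero (((tensorFunctor R S C).leftDerived n).obj A)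

/-! ### Semidualizing bimodules, Auslander and Bass classes -/

/-- The `(R, S)`-bimodule `C` is semidualizing. -/
structure IsSemidualizing : Prop where
  /-- `_R C` has a resolution by finitely generated projective `R`-modules. -/
  left_resolution : ∃ P : ProjectiveResolution (ModuleCat.of R C),
    ∀ n, Module.Finite R (P.complex.X n)
  /-- `C_S` has a resolution by finitely generated projective right `S`-modules. -/
  right_resolution : ∃ P : ProjectiveResolution (ModuleCat.of Sᵐᵒᵖ C),
    ∀ n, Module.Finite Sᵐᵒᵖ (P.complex.X n)
  /-- The homothety map `R → Hom_{Sᵒᵖ}(C, C)`, `r ↦ (c ↦ r c)`, is an isomorphism. -/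
  left_homothety : Function.Bijective (leftMul R S C)
  /-- The homothety map `S → Hom_R(C, C)`, `s ↦ (c ↦ c s)`, is an isomorphism. -/
  right_homothety : Function.Bijective (rightMul R S C)
  /-- `Ext_R^n(C, C) = 0` for `n ≥ 1`. -/
  left_ext : ∀ n : ℕ, 1 ≤ n → Subsingleton (Abelian.Ext (ModuleCat.of R C) (ModuleCat.of R C) n)
  /-- `Ext_{Sᵒᵖ}^n(C, C) = 0` for `n ≥ 1`. -/
  right_ext : ∀ n : ℕ, 1 ≤ n →
    Subsingleton (Abelian.Ext (ModuleCat.of Sᵐᵒᵖ C) (ModuleCat.of Sᵐᵒᵖ C) n)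

/-- The Auslander class `𝒜_C(S)` in `Mod S`: the `A` with `Tor_n^S(C, A) = 0` and
`Ext_R^n(C, C ⊗_S A) = 0` for all `n ≥ 1` and with `μ_A` an isomorphism. -/
def auslanderClass : ObjectProperty (ModuleCat.{u} S) := fun A =>
  (∀ n : ℕ, 1 ≤ n → TorVanishes R S C n A) ∧
  (∀ n : ℕ, 1 ≤ n →
    Subsingleton (Abelian.Ext (ModuleCat.of R C) ((tensorFunctor R S C).obj A) n)) ∧
  IsIso (muMap R S C A)

/-- The Bass class `ℬ_C(R)` in `Mod R`: the `M` with `Ext_R^n(C, M) = 0` and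
`Tor_n^S(C, Hom_R(C, M)) = 0` for all `n ≥ 1` and with `θ_M` an isomorphism. -/
def bassClass : ObjectProperty (ModuleCat.{u} R) := fun M =>
  (∀ n : ℕ, 1 ≤ n → Subsingleton (Abelian.Ext (ModuleCat.of R C) M n)) ∧
  (∀ n : ℕ, 1 ≤ n → TorVanishes R S C n ((homFunctor R S C).obj M)) ∧
  IsIso (thetaMap R S C M)

end Bimodule

/-!
`C ⊗_S -` is left adjoint to `Hom_R(C, -)`, with unit `μ` and counit `θ`. By the triangle
identities the two functors exchange the Auslander and the Bass class (Foxby equivalence), and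
`θ_M ∘ (1_C ⊗ g)` is the adjoint transpose of `g`. Factorizations through `g` and endomorphisms
over `g` then correspond to those of its transpose.
-/

section Adjunction

variable {𝒞 𝒟 : Type*} [Category 𝒞] [Category 𝒟] {F : 𝒞 ⥤ 𝒟} {G : 𝒟 ⥤ 𝒞}

theorem isIso_counit_app_leftAdjoint_obj (adj : F ⊣ G) (A : 𝒞) [IsIso (adj.unit.app A)] :
    IsIso (adj.counit.app (F.obj A)) :=
  isIso_of_hom_comp_eq_id _ (adj.left_triangle_components A)

theorem isIso_unit_app_rightAdjoint_obj (adj : F ⊣ G) (X : 𝒟) [IsIso (adj.counit.app X)] :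
    IsIso (adj.unit.app (G.obj X)) :=
  isIso_of_comp_hom_eq_id _ (adj.right_triangle_components X)

theorem leftAdjoint_map_surjective_of_isIso_unit_app (adj : F ⊣ G) (A' A : 𝒞)
    [IsIso (adj.unit.app A)] : Function.Surjective (F.map : (A' ⟶ A) → (F.obj A' ⟶ F.obj A)) := by
  intro h
  refine ⟨adj.homEquiv A' (F.obj A) h ≫ inv (adj.unit.app A), (adj.homEquiv _ _).injective ?_⟩
  rw [adj.homEquiv_unit, adj.unit_naturality, Category.assoc, IsIso.inv_hom_id, Category.comp_id]

end Adjunction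

section CoverTransport

variable {R S : Type u} [Ring R] [Ring S]
variable {F : ModuleCat.{u} S ⥤ ModuleCat.{u} R} {G : ModuleCat.{u} R ⥤ ModuleCat.{u} S}
variable {𝒜 : ObjectProperty (ModuleCat.{u} S)} {ℬ : ObjectProperty (ModuleCat.{u} R)}
variable {A : ModuleCat.{u} S} {M : ModuleCat.{u} R} {g : A ⟶ G.obj M}

theorem IsPrecover.homEquiv_symm (adj : F ⊣ G) (hF : 𝒜 ≤ ℬ.inverseImage F)
    (hG : ℬ ≤ 𝒜.inverseImage G) (hcounit : ∀ X, ℬ X → IsIso (adj.counit.app X))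
    (hg : IsPrecover 𝒜 g) : IsPrecover ℬ ((adj.homEquiv A M).symm g) := by
  obtain ⟨hA, lift⟩ := hg
  refine ⟨hF A hA, fun X hX f => ?_⟩
  have := hcounit X hX
  obtain ⟨k, hk : k ≫ g = G.map f⟩ := lift (G.obj X) (hG X hX) (G.map f)
  refine ⟨inv (adj.counit.app X) ≫ F.map k, ?_⟩
  calc (inv (adj.counit.app X) ≫ F.map k) ≫ (adj.homEquiv A M).symm g
      = inv (adj.counit.app X) ≫ (adj.homEquiv _ M).symm (k ≫ g) := by
        rw [Category.assoc, adj.homEquiv_naturality_left_symm]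
    _ = inv (adj.counit.app X) ≫ adj.counit.app X ≫ f := by
        rw [hk, adj.homEquiv_counit, adj.counit_naturality]
    _ = f := IsIso.inv_hom_id_assoc _ f

theorem IsRightMinimal.homEquiv_symm (adj : F ⊣ G) [IsIso (adj.unit.app A)]
    (hg : IsRightMinimal g) : IsRightMinimal ((adj.homEquiv A M).symm g) := by
  intro h hh
  obtain ⟨k, rfl⟩ := leftAdjoint_map_surjective_of_isIso_unit_app adj A A h
  have hk : k ≫ g = g := by
    apply (adj.homEquiv A M).symm.injective
    rw [adj.homEquiv_naturality_left_symm, hh]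
  have := hg k hk
  infer_instance

theorem IsCover.homEquiv_symm (adj : F ⊣ G) (hF : 𝒜 ≤ ℬ.inverseImage F)
    (hG : ℬ ≤ 𝒜.inverseImage G) (hunit : ∀ A', 𝒜 A' → IsIso (adj.unit.app A'))
    (hcounit : ∀ X, ℬ X → IsIso (adj.counit.app X)) (hg : IsCover 𝒜 g) :
    IsCover ℬ ((adj.homEquiv A M).symm g) :=
  have := hunit A hg.1.1
  ⟨hg.1.homEquiv_symm adj hF hG hcounit, hg.2.homEquiv_symm adj⟩

end CoverTransport

theorem subsingleton_ext_of_iso {𝒞 : Type*} [Category 𝒞] [Abelian 𝒞] [HasExt 𝒞] {X Y Y' : 𝒞}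
    (e : Y ≅ Y') {n : ℕ} (h : Subsingleton (Abelian.Ext X Y n)) :
    Subsingleton (Abelian.Ext X Y' n) :=
  (Equiv.subsingleton_congr
    ((Abelian.extFunctorObj X n).mapIso e).addCommGroupIsoToAddEquiv.toEquiv).mp h

section FoxbyEquivalence

variable {R S : Type u} [Ring R] [Ring S]
variable {C : Type u} [AddCommGroup C] [Module R C] [Module Sᵐᵒᵖ C] [SMulCommClass R Sᵐᵒᵖ C]

theorem TorVanishes.of_iso {A A' : ModuleCat.{u} S} (e : A ≅ A') {n : ℕ}
    (h : TorVanishes R S C n A) : TorVanishes R S C n A' :=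
  Limits.IsZero.of_iso h (((tensorFunctor R S C).leftDerived n).mapIso e.symm)

variable (R S C) in
/-- The tensor-hom adjunction `C ⊗_S - ⊣ Hom_R(C, -)`, with unit `μ` and counit `θ`. -/
def tensorHomAdjunction : tensorFunctor R S C ⊣ homFunctor R S C where
  unit :=
    { app := muMap R S C
      naturality := fun _ _ _ => rfl }
  counit :=
    { app := thetaMap R S C
      naturality := fun _ _ _ => by
        ext1
        exact bimodTensor_hom_ext R S fun _ _ => rfl }
  left_triangle_components _ := by
    ext1
    exact bimodTensor_hom_ext R S fun _ _ => rfl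
  right_triangle_components _ := rfl

theorem auslanderClass_le_inverseImage_bassClass :
    auslanderClass R S C ≤ (bassClass R S C).inverseImage (tensorFunctor R S C) :=
  fun A ⟨tor, ext, (_ : IsIso ((tensorHomAdjunction R S C).unit.app A))⟩ =>
    ⟨ext, fun n hn => (tor n hn).of_iso (asIso ((tensorHomAdjunction R S C).unit.app A)),
      isIso_counit_app_leftAdjoint_obj (tensorHomAdjunction R S C) A⟩

theorem bassClass_le_inverseImage_auslanderClass :
    bassClass R S C ≤ (auslanderClass R S C).inverseImage (homFunctor R S C) :=
  fun X ⟨ext, tor, (_ : IsIso ((tensorHomAdjunction R S C).counit.app X))⟩ =>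
    ⟨tor, fun n hn => subsingleton_ext_of_iso
        (asIso ((tensorHomAdjunction R S C).counit.app X)).symm (ext n hn),
      isIso_unit_app_rightAdjoint_obj (tensorHomAdjunction R S C) X⟩

theorem proposition3p8_general {M : ModuleCat.{u} R} {A : ModuleCat.{u} S}
    {g : A ⟶ (homFunctor R S C).obj M} (hg : IsCover (auslanderClass R S C) g) :
    IsCover (bassClass R S C) ((tensorFunctor R S C).map g ≫ thetaMap R S C M) :=
  hg.homEquiv_symm (tensorHomAdjunction R S C) auslanderClass_le_inverseImage_bassClass
    bassClass_le_inverseImage_auslanderClass (fun _ hA => hA.2.2) fun _ hX => hX.2.2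

end FoxbyEquivalence

theorem proposition3p8 {R S : Type u} [Ring R] [Ring S]
    {C : Type u} [AddCommGroup C] [Module R C] [Module Sᵐᵒᵖ C] [SMulCommClass R Sᵐᵒᵖ C]
    (hC : IsSemidualizing R S C)
    (M : ModuleCat.{u} R) (A : ModuleCat.{u} S) (g : A ⟶ (homFunctor R S C).obj M)
    (hg : IsCover (auslanderClass R S C) g) :
    IsCover (bassClass R S C) ((tensorFunctor R S C).map g ≫ thetaMap R S C M) :=
  proposition3p8_general hg
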